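/- There is an absolute constant $c>0$ such that the following holds. Let $n\ge 1$ and $0\le r<p$ be integers, let $\mathcal C\subseteq\mathbb R^p$ be convex, let $f_1,\dots,f_n:\mathbb R^p\to\mathbb R$ be twice continuously differentiable near every point of $\mathcal C$, and put $f=\frac1n\sum_{i=1}^n f_i$. Let $\theta_*\in\mathcal C$ be a minimizer of $f$ over $\mathbb R^p$. For a finite (multi)set $S$ of indices from $[n]=\{1,\dots,n\}$, of cardinality $|S|$ counted with multiplicity, let $\mathbf H_S(\theta)=\frac1{|S|}\sum_{i\in S}\nabla^2 f_i(\theta)$. Write $\|\cdot\|$ for the Euclidean norm of vectors and the spectral norm of matrices. Assume: (i) (Lipschitz Hessians) for constants $M_1,\dots,M_n$ and every non-empty $S\subseteq[n]$, $\|\mathbf H_S(\theta)-\mathbf H_S(\theta')\|\le M_{|S|}\|\theta-\theta'\|$ for all $\theta,\theta'\in\mathcal C$; (ii) (bounded Hessians) $\|\nabla^2 f_i(\theta)\|\le K$ for all $i\le n$ and $\theta\in\mathcal C$. Let $S_0,S_1,\dots$ be random samples of prescribed sizes $|S_t|\ge1$, where each $S_t$ is drawn uniformly from $[n]$, with or without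 replacement, independently of $(S_\tau)_{\tau<t}$. Let $\hat\theta^t$ be the iterates of NewSamp: $\hat\theta^0\in\mathcal C$ is fixed and $$\hat\theta^{t+1}=\mathcal P_{\mathcal C}\bigl(\hat\theta^t-\eta_t\mathbf Q^t\nabla f(\hat\theta^t)\bigr),\qquad \mathbf Q^t=\tfrac1{\lambda^t_{r+1}}\mathbf I_p+\mathbf U_r\bigl(\mathbf\Lambda_r^{-1}-\tfrac1{\lambda^t_{r+1}}\mathbf I_r\bigr)\mathbf U_r^{T},$$ where $\mathcal P_{\mathcal C}$ is the Euclidean projection onto $\mathcal C$ (assumed to exist at the points where it is used), $\lambda_1^t\ge\dots\ge\lambda_p^t$ are the eigenvalues of $\mathbf H_{S_t}(\hat\theta^t)$, $\mathbf\Lambda_r=\mathrm{diag}(\lambda^t_1,\dots,\lambda^t_r)$, the columns of $\mathbf U_r$ are corresponding orthonormal eigenvectors, and the step sizes $\eta_t\ge0$ are deterministic or functions of $S_0,\dots,S_t$ (with the convention $x^{-1}=0$ for $x=0$ in $\mathbf Q^t$, which does not affect the iterations considered below). Then for each $t\ge 0$, with probability at least $1-2/p$: if $\lambda^t_{r+1}>0$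 and $\eta_t\le \dfrac{2}{1+\lambda^t_p/\lambda^t_{r+1}}$, then $$\|\hat\theta^{t+1}-\theta_*\|\le\xi_1^t\|\hat\theta^t-\theta_*\|+\xi_2^t\|\hat\theta^t-\theta_*\|^2,$$ $$\xi_1^t=1-\eta_t\frac{\lambda_p^t}{\lambda_{r+1}^t}+\eta_t\frac{cK}{\lambda^t_{r+1}}\sqrt{\frac{\log p}{|S_t|}},\qquad \xi_2^t=\eta_t\frac{M_n}{2\lambda^t_{r+1}}.$$ In particular, if $\lambda^t_{r+1}>0$ and the step-size condition hold almost surely, the inequality holds with probability at least $1-2/p$. -/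

import Mathlib

open MeasureTheory ProbabilityTheory

noncomputable section

namespace NewSamp

/-- The parameter space `ℝ^p` with its Euclidean norm. -/
abbrev Param (p : ℕ) : Type := EuclideanSpace ℝ (Fin p)

/-- Linear operators on `ℝ^p`; the norm on this type is the spectral norm. -/
abbrev Op (p : ℕ) : Type := Param p →L[ℝ] Param p

/-- The average `f = (1/n) ∑ f_i`. -/
def objective {n p : ℕ} (f : Fin n → Param p → ℝ) (θ : Param p) : ℝ :=
  (1 / (n : ℝ)) * ∑ i, f i θ

/-- The Hessian of `g` at `θ`, i.e. the derivative of the gradient. -/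
def hessian {p : ℕ} (g : Param p → ℝ) (θ : Param p) : Op p :=
  fderiv ℝ (gradient g) θ

/-- The sub-sampled Hessian `H_S(θ) = (1/|S|) ∑_{i ∈ S} ∇² f_i(θ)`. Samples are multisets of indices,
so that samples drawn with replacement are counted with multiplicity. -/
def subHessian {n p : ℕ} (f : Fin n → Param p → ℝ) (S : Multiset (Fin n)) (θ : Param p) : Op p :=
  (1 / (Multiset.card S : ℝ)) • (S.map fun i => hessian (f i) θ).sum

open Classical in
/-- The `k`-th largest eigenvalue (`1 ≤ k ≤ p`, with multiplicity) of a symmetric operator. -/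
def eigval {p : ℕ} (T : Op p) (k : ℕ) : ℝ :=
  if h : (T : Param p →ₗ[ℝ] Param p).IsSymmetric ∧ 1 ≤ k ∧ k ≤ p then
    h.1.eigenvalues finrank_euclideanSpace_fin ⟨k - 1, by omega⟩
  else 0

open Classical in
/-- A unit eigenvector for `eigval T k`; for `1 ≤ k ≤ p` these form an orthonormal basis. -/
def eigvec {p : ℕ} (T : Op p) (k : ℕ) : Param p :=
  if h : (T : Param p →ₗ[ℝ] Param p).IsSymmetric ∧ 1 ≤ k ∧ k ≤ p then
    h.1.eigenvectorBasis finrank_euclideanSpace_fin ⟨k - 1, by omega⟩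
  else 0

/-- The rank-thresholded inverse
`Q = λ_{r+1}⁻¹ I + U_r (Λ_r⁻¹ - λ_{r+1}⁻¹ I_r) U_rᵀ`, where the columns of `U_r` are the
eigenvectors `u_1, …, u_r` and `Λ_r = diag(λ_1, …, λ_r)`. -/
def thresholdedInverse {p : ℕ} (r : ℕ) (T : Op p) : Op p :=
  (eigval T (r + 1))⁻¹ • ContinuousLinearMap.id ℝ (Param p) +
    ∑ k ∈ Finset.Icc 1 r, ((eigval T k)⁻¹ - (eigval T (r + 1))⁻¹) •
      InnerProductSpace.rankOne ℝ (eigvec T k) (eigvec T k)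

/-- `y` is a Euclidean projection of `x` onto `C`. -/
def IsProjection {p : ℕ} (C : Set (Param p)) (x y : Param p) : Prop :=
  y ∈ C ∧ ∀ z ∈ C, ‖x - y‖ ≤ ‖x - z‖

/-- `θ` is the sequence of iterates of NewSamp with rank threshold `r`, step sizes `η t` and
samples `S t`: `θ^{t+1} = P_C (θ^t - η_t Q^t ∇f(θ^t))`. -/
def IsRun {n p : ℕ} (f : Fin n → Param p → ℝ) (C : Set (Param p)) (r : ℕ)
    (η : ℕ → ℝ) (S : ℕ → Multiset (Fin n)) (θ : ℕ → Param p) : Prop :=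
  ∀ t, IsProjection C
    (θ t - η t • thresholdedInverse r (subHessian f (S t) (θ t)) (gradient (objective f) (θ t)))
    (θ (t + 1))

/-- Samples carry the discrete σ-algebra. -/
instance sampleMeasurableSpace (n : ℕ) : MeasurableSpace (Multiset (Fin n)) := ⊤

/-- The law of `m` independent uniform draws from the `n` indices. -/
def withReplacement (n m : ℕ) [NeZero n] : PMF (Multiset (Fin n)) :=
  (PMF.uniformOfFintype (Fin m → Fin n)).map fun s => Finset.univ.val.map s

/-- The law of a uniformly chosen subset of size `m` of the `n` indices. -/
def withoutReplacement (n m : ℕ) (h : m ≤ n) : PMF (Multiset (Fin n)) :=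
  (PMF.uniformOfFinset (Finset.powersetCard m (Finset.univ : Finset (Fin n)))
    (Finset.powersetCard_nonempty.2 (by simpa using h))).map Finset.val

/-- `X` is a uniform random sample of size `m`, drawn with or without replacement. -/
def IsUniformSample {Ω : Type*} [MeasurableSpace Ω] (μ : Measure Ω) {n : ℕ} [NeZero n]
    (m : ℕ) (X : Ω → Multiset (Fin n)) : Prop :=
  Measurable X ∧
    (μ.map X = (withReplacement n m).toMeasure ∨
      ∃ h : m ≤ n, μ.map X = (withoutReplacement n m h).toMeasure)

/-- Independent sub-sampling: every `S t` is a uniform sample of size `m t`, independent of the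
earlier samples `S τ`, `τ < t`. -/
def IsIndependentSampling {Ω : Type*} [MeasurableSpace Ω] (μ : Measure Ω) {n : ℕ} [NeZero n]
    (m : ℕ → ℕ) (S : ℕ → Ω → Multiset (Fin n)) : Prop :=
  ∀ t, IsUniformSample μ (m t) (S t) ∧
    IndepFun (S t) (fun ω (τ : Fin t) => S τ ω) μ

/-- The coefficient `ξ₁` of the linear term, with `lp = λ_p`, `lr = λ_{r+1}` and `m = |S_t|`. -/
def xi₁ (c K η lp lr : ℝ) (p m : ℕ) : ℝ :=
  1 - η * (lp / lr) + η * (c * K / lr) * Real.sqrt (Real.log p / m)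

/-- The coefficient `ξ₂` of the quadratic term, with `lr = λ_{r+1}`. -/
def xi₂ (M η lr : ℝ) : ℝ := η * (M / (2 * lr))

end NewSamp

end

/-!
The deviation of `θ^{t+1}` from the minimizer splits, since the projection onto a convex set does not
increase the distance to points of that set, into three parts: `(I - η Q H_S)(θ^t - θ_*)`,
`η Q (H_S - H_[n])(θ^t - θ_*)`, and `η Q` applied to the first-order Taylor remainder of the gradient
(`norm_step_sub_le`). `Q` and `H_S` are diagonal in the same basis, so the norms of `Q` and
`I - η Q H_S` are read off from eigenvalues, and the Taylor remainder is at most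
`M_n / 2 * ‖θ^t - θ_*‖²`. All of this is deterministic; the only random ingredient is the bound
`‖H_S - H_[n]‖ ≤ 12 K √(log p / m)`, off an event of probability at most `1 / p`.

That bound comes from the method of exchangeable pairs, applied to the even spectral moments
`∑ i, λ_i(X) ^ (2 q)` of the centred sum `X` over the sample. Replace one draw at random (sampling with
replacement), or exchange the labels of two indices (without replacement): this is a reversible random
move `z ↦ z'` with `E[X z - X z'] = α X z`. By reversibility the moment of order `2 q + 2` is
controlled by the average of `tr ((X z - X z') (X z ^ (2 q + 1) - X z' ^ (2 q + 1)))`. Expanded in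
eigenbases of `X z` and `X z'`, that trace is a double sum of
`(x - y) (x ^ (2 q + 1) - y ^ (2 q + 1))` with nonnegative weights, hence at most
`(2 q + 1) ‖X z - X z'‖²` times moments of order `2 q` (`trace_sub_mul_pow_sub_pow_le`). Iterating
(`moment_le`) and applying Markov's inequality with `q = ⌈log p⌉` gives `card_norm_gt_mul_le`, which
covers both sampling schemes. No matrix exponentials or trace inequalities beyond this are needed.

Finally `θ^t` is a function of the earlier samples, because projections onto convex sets are unique, and
`S_t` is independent of those, so the bound for a fixed point applies at `θ^t` by Fubini's theorem. For
`p ≤ 2` the claimed probability is not positive.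
-/

namespace NewSamp

/-! ### Spectral moments of two symmetric operators -/

theorem norm_le_of_eigenbasis {E ι : Type*} [NormedAddCommGroup E] [InnerProductSpace ℝ E]
    [Fintype ι] (b : OrthonormalBasis ι ℝ E) (a : ι → ℝ) (T : E →L[ℝ] E)
    (hT : ∀ i, T (b i) = a i • b i) {s : ℝ} (hs : 0 ≤ s) (ha : ∀ i, |a i| ≤ s) : ‖T‖ ≤ s := by
  refine T.opNorm_le_bound hs fun x => ?_
  have hrepr : ∀ i, b.repr (T x) i = a i * b.repr x i := by
    intro i
    rw [b.repr_apply_apply]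
    conv_lhs => rw [← b.sum_repr x]
    simp only [map_sum, map_smul, hT, smul_smul]
    rw [b.orthonormal.inner_right_fintype, mul_comm]
  have hsq : ‖T x‖ ^ 2 ≤ (s * ‖x‖) ^ 2 := by
    rw [← b.repr.norm_map (T x), ← b.repr.norm_map x, mul_pow, EuclideanSpace.norm_sq_eq,
      EuclideanSpace.norm_sq_eq, Finset.mul_sum]
    refine Finset.sum_le_sum fun i _ => ?_
    rw [hrepr, norm_mul, mul_pow]
    gcongr
    exact ha i
  exact le_of_sq_le_sq hsq (by positivity)

theorem sub_mul_pow_sub_pow_le (x y : ℝ) (q : ℕ) :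
    (x - y) * (x ^ (2 * q + 1) - y ^ (2 * q + 1)) ≤
      (2 * q + 1) * ((x - y) ^ 2 * (x ^ (2 * q) + y ^ (2 * q))) := by
  have hgeom := (Commute.all x y).geom_sum₂_mul (2 * q + 1)
  have hterm : ∀ i ∈ Finset.range (2 * q + 1),
      x ^ i * y ^ (2 * q + 1 - 1 - i) ≤ x ^ (2 * q) + y ^ (2 * q) := by
    intro i hi
    have hi' : i ≤ 2 * q := by simpa [Nat.lt_succ_iff] using hi
    have hx : x ^ (2 * q) = |x| ^ (2 * q) := by rw [pow_mul, pow_mul, sq_abs]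
    have hy : y ^ (2 * q) = |y| ^ (2 * q) := by rw [pow_mul, pow_mul, sq_abs]
    calc x ^ i * y ^ (2 * q + 1 - 1 - i) ≤ |x| ^ i * |y| ^ (2 * q - i) := by
          rw [Nat.add_sub_cancel, ← abs_pow, ← abs_pow, ← abs_mul]
          exact le_abs_self _
      _ ≤ max |x| |y| ^ i * max |x| |y| ^ (2 * q - i) := by
          gcongr
          · exact le_max_left _ _
          · exact le_max_right _ _
      _ = max |x| |y| ^ (2 * q) := by rw [← pow_add, Nat.add_sub_cancel' hi']
      _ ≤ x ^ (2 * q) + y ^ (2 * q) := by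
          rw [hx, hy]
          rcases max_choice |x| |y| with h | h <;> rw [h]
          · exact le_add_of_nonneg_right (by positivity)
          · exact le_add_of_nonneg_left (by positivity)
  have hsum := Finset.sum_le_card_nsmul _ _ _ hterm
  rw [Finset.card_range, nsmul_eq_mul] at hsum
  rw [Nat.cast_add, Nat.cast_mul, Nat.cast_ofNat, Nat.cast_one] at hsum
  rw [← hgeom]
  calc _ = (x - y) ^ 2 * ∑ i ∈ Finset.range (2 * q + 1), x ^ i * y ^ (2 * q + 1 - 1 - i) := by ring
    _ ≤ (x - y) ^ 2 * ((2 * q + 1) * (x ^ (2 * q) + y ^ (2 * q))) := by gcongr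
    _ = _ := by ring

section Spectral

variable {E ι : Type*} [NormedAddCommGroup E] [InnerProductSpace ℝ E] [Fintype ι]

/-- Matrix entries of `T - U` between an eigenvector of `T` and one of `U`. The double-sum formulas below
expand in these entries. -/
theorem inner_sub_apply_eigenvector {T U : E →L[ℝ] E} (hU : (U : E →ₗ[ℝ] E).IsSymmetric)
    {u v : E} {x y : ℝ} (hu : T u = x • u) (hv : U v = y • v) :
    inner ℝ ((T - U) u) v = (x - y) * inner ℝ u v := by
  have h := hU u v
  simp only [ContinuousLinearMap.coe_coe, hv] at h
  rw [sub_apply, inner_sub_left, h, hu, real_inner_smul_left,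
    real_inner_smul_right]
  ring

theorem inner_sub_apply_self {T U : E →L[ℝ] E} (hU : (U : E →ₗ[ℝ] E).IsSymmetric)
    {u : E} {x : ℝ} (hu : T u = x • u) (b : OrthonormalBasis ι ℝ E) {a : ι → ℝ}
    (hb : ∀ j, U (b j) = a j • b j) :
    inner ℝ ((T - U) u) u = ∑ j, (x - a j) * inner ℝ u (b j) ^ 2 := by
  rw [← b.sum_inner_mul_inner]
  refine Finset.sum_congr rfl fun j _ => ?_
  rw [inner_sub_apply_eigenvector hU hu (hb j), real_inner_comm u (b j)]
  ring

theorem sum_sq_sub_mul_inner_sq_le {T U : E →L[ℝ] E} (hU : (U : E →ₗ[ℝ] E).IsSymmetric)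
    {u : E} (hu1 : ‖u‖ = 1) {x : ℝ} (hu : T u = x • u) (b : OrthonormalBasis ι ℝ E) {a : ι → ℝ}
    (hb : ∀ j, U (b j) = a j • b j) :
    ∑ j, (x - a j) ^ 2 * inner ℝ u (b j) ^ 2 ≤ ‖T - U‖ ^ 2 := by
  have h1 : ∑ j, (x - a j) ^ 2 * inner ℝ u (b j) ^ 2 = ‖(T - U) u‖ ^ 2 := by
    rw [← b.sum_sq_norm_inner_left]
    refine Finset.sum_congr rfl fun j _ => ?_
    rw [inner_sub_apply_eigenvector hU hu (hb j), Real.norm_eq_abs, sq_abs, mul_pow]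
  rw [h1]
  gcongr
  simpa [hu1] using (T - U).le_opNorm u

/-- The left-hand side is `tr ((T - U) (T ^ (2 q + 1) - U ^ (2 q + 1)))`, with each power evaluated in
an eigenbasis of its own operator. -/
theorem trace_sub_mul_pow_sub_pow_le {T U : E →L[ℝ] E}
    (hT : (T : E →ₗ[ℝ] E).IsSymmetric) (hU : (U : E →ₗ[ℝ] E).IsSymmetric)
    (b b' : OrthonormalBasis ι ℝ E) {a a' : ι → ℝ} (hb : ∀ i, T (b i) = a i • b i)
    (hb' : ∀ i, U (b' i) = a' i • b' i) (q : ℕ) :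
    ∑ i, a i ^ (2 * q + 1) * inner ℝ ((T - U) (b i)) (b i) +
        ∑ i, a' i ^ (2 * q + 1) * inner ℝ ((U - T) (b' i)) (b' i) ≤
      (2 * q + 1) * (‖T - U‖ ^ 2 * (∑ i, a i ^ (2 * q) + ∑ i, a' i ^ (2 * q))) := by
  have hl : ∀ i, inner ℝ ((T - U) (b i)) (b i) = _ :=
    fun i => inner_sub_apply_self hU (hb i) b' hb'
  have hr : ∀ j, inner ℝ ((U - T) (b' j)) (b' j) = _ :=
    fun j => inner_sub_apply_self hT (hb' j) b hb
  have hl' : ∑ i, ∑ j, (a i - a' j) ^ 2 * inner ℝ (b i) (b' j) ^ 2 * a i ^ (2 * q) ≤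
      ‖T - U‖ ^ 2 * ∑ i, a i ^ (2 * q) := by
    rw [Finset.mul_sum]
    refine Finset.sum_le_sum fun i _ => ?_
    rw [← Finset.sum_mul]
    exact mul_le_mul_of_nonneg_right
      (sum_sq_sub_mul_inner_sq_le hU (b.orthonormal.1 i) (hb i) b' hb')
      ((even_two_mul q).pow_nonneg _)
  have hr' : ∑ i, ∑ j, (a i - a' j) ^ 2 * inner ℝ (b i) (b' j) ^ 2 * a' j ^ (2 * q) ≤
      ‖T - U‖ ^ 2 * ∑ j, a' j ^ (2 * q) := by
    rw [Finset.sum_comm, Finset.mul_sum]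
    refine Finset.sum_le_sum fun j _ => ?_
    rw [← Finset.sum_mul]
    refine mul_le_mul_of_nonneg_right ?_ ((even_two_mul q).pow_nonneg _)
    have h := sum_sq_sub_mul_inner_sq_le hT (b'.orthonormal.1 j) (hb' j) b hb
    rw [norm_sub_rev] at h
    refine le_trans (le_of_eq (Finset.sum_congr rfl fun i _ => ?_)) h
    rw [real_inner_comm (b i) (b' j)]
    ring
  calc _ = ∑ i, ∑ j, (a i - a' j) * (a i ^ (2 * q + 1) - a' j ^ (2 * q + 1)) *
          inner ℝ (b i) (b' j) ^ 2 := by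
        simp_rw [hl, hr, Finset.mul_sum]
        rw [Finset.sum_comm (f := fun i j => a' i ^ (2 * q + 1) * _), ← Finset.sum_add_distrib]
        refine Finset.sum_congr rfl fun i _ => ?_
        rw [← Finset.sum_add_distrib]
        refine Finset.sum_congr rfl fun j _ => ?_
        rw [real_inner_comm (b i) (b' j)]
        ring
    _ ≤ ∑ i, ∑ j, ((2 * q + 1) * ((a i - a' j) ^ 2 * inner ℝ (b i) (b' j) ^ 2 * a i ^ (2 * q)) +
          (2 * q + 1) * ((a i - a' j) ^ 2 * inner ℝ (b i) (b' j) ^ 2 * a' j ^ (2 * q))) := by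
        refine Finset.sum_le_sum fun i _ => Finset.sum_le_sum fun j _ => ?_
        refine (mul_le_mul_of_nonneg_right (sub_mul_pow_sub_pow_le (a i) (a' j) q)
          (sq_nonneg _)).trans (le_of_eq ?_)
        ring
    _ ≤ _ := by
        simp_rw [Finset.sum_add_distrib, ← Finset.mul_sum]
        rw [← mul_add, mul_add (‖T - U‖ ^ 2)]
        gcongr

end Spectral

/-! ### Moments and tails under a reversible family of moves -/

section Moments

variable {E ι Z J : Type*} [NormedAddCommGroup E] [InnerProductSpace ℝ E] [Fintype ι]
  [Fintype Z] [Fintype J]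

/-- One step of the exchangeable-pairs recursion. The hypothesis `hτ` says that the pair formed by a
uniform point `z` and its image under a uniform move `τ j` is exchangeable. -/
theorem moment_succ_le {τ : J → Z → Z}
    (hτ : ∀ F : Z → Z → ℝ, ∑ z, ∑ j, F z (τ j z) = ∑ z, ∑ j, F (τ j z) z)
    {X : Z → E →L[ℝ] E} (hX : ∀ z, (X z : E →ₗ[ℝ] E).IsSymmetric) {α B : ℝ}
    (hα : ∀ z, ∑ j, (X z - X (τ j z)) = α • X z) (hB : ∀ z, ∑ j, ‖X z - X (τ j z)‖ ^ 2 ≤ B)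
    (b : Z → OrthonormalBasis ι ℝ E) {a : Z → ι → ℝ}
    (hb : ∀ z i, X z (b z i) = a z i • b z i) (q : ℕ) :
    α * ∑ z, ∑ i, a z i ^ (2 * (q + 1)) ≤ (2 * q + 1) * B * ∑ z, ∑ i, a z i ^ (2 * q) := by
  set G : Z → Z → ℝ := fun z z' =>
    ∑ i, a z i ^ (2 * q + 1) * inner ℝ ((X z - X z') (b z i)) (b z i) with hG
  set φ : Z → ℝ := fun z => ∑ i, a z i ^ (2 * q) with hφ
  have hφ0 : ∀ z, 0 ≤ φ z := fun z =>
    Finset.sum_nonneg fun i _ => (even_two_mul q).pow_nonneg _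
  have h1 : α * ∑ z, ∑ i, a z i ^ (2 * (q + 1)) = ∑ z, ∑ j, G z (τ j z) := by
    rw [Finset.mul_sum]
    refine Finset.sum_congr rfl fun z _ => ?_
    rw [hG, Finset.sum_comm, Finset.mul_sum]
    refine Finset.sum_congr rfl fun i _ => ?_
    rw [← Finset.mul_sum, ← sum_inner, ← sum_apply, hα,
      smul_apply, hb, real_inner_smul_left, real_inner_smul_left,
      real_inner_self_eq_norm_sq, (b z).orthonormal.1 i]
    ring
  have h2 : ∀ z z', G z z' + G z' z ≤ (2 * q + 1) * (‖X z - X z'‖ ^ 2 * (φ z + φ z')) :=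
    fun z z' => trace_sub_mul_pow_sub_pow_le (hX z) (hX z') (b z) (b z') (hb z) (hb z') q
  have h3 : 2 * ∑ z, ∑ j, G z (τ j z) ≤
      (2 * q + 1) * (∑ z, ∑ j, ‖X z - X (τ j z)‖ ^ 2 * (φ z + φ (τ j z))) := by
    rw [two_mul]
    -- Reversibility symmetrizes one of the two copies, which produces `T ^ k - U ^ k` in the trace.
    nth_rewrite 2 [hτ]
    simp_rw [Finset.mul_sum, ← Finset.sum_add_distrib]
    exact Finset.sum_le_sum fun z _ => Finset.sum_le_sum fun j _ => h2 _ _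
  have h4 : ∑ z, ∑ j, ‖X z - X (τ j z)‖ ^ 2 * (φ z + φ (τ j z)) =
      2 * ∑ z, (∑ j, ‖X z - X (τ j z)‖ ^ 2) * φ z := by
    have h := hτ fun z z' => ‖X z - X z'‖ ^ 2 * φ z'
    simp_rw [mul_add, Finset.sum_add_distrib]
    rw [h, two_mul]
    simp_rw [Finset.sum_mul, norm_sub_rev (X (τ _ _))]
  have h5 : ∑ z, (∑ j, ‖X z - X (τ j z)‖ ^ 2) * φ z ≤ B * ∑ z, φ z := by
    rw [Finset.mul_sum]
    exact Finset.sum_le_sum fun z _ => mul_le_mul_of_nonneg_right (hB z) (hφ0 z)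
  rw [h4] at h3
  rw [h1]
  have h6 : (2 * (q : ℝ) + 1) * (2 * ∑ z, (∑ j, ‖X z - X (τ j z)‖ ^ 2) * φ z) ≤
      (2 * q + 1) * (2 * (B * ∑ z, φ z)) := by gcongr
  linarith

theorem moment_le {τ : J → Z → Z}
    (hτ : ∀ F : Z → Z → ℝ, ∑ z, ∑ j, F z (τ j z) = ∑ z, ∑ j, F (τ j z) z)
    {X : Z → E →L[ℝ] E} (hX : ∀ z, (X z : E →ₗ[ℝ] E).IsSymmetric) {α V : ℝ} (hα0 : 0 < α)
    (hV : 0 ≤ V) (hα : ∀ z, ∑ j, (X z - X (τ j z)) = α • X z)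
    (hB : ∀ z, ∑ j, ‖X z - X (τ j z)‖ ^ 2 ≤ α * V)
    (b : Z → OrthonormalBasis ι ℝ E) {a : Z → ι → ℝ}
    (hb : ∀ z i, X z (b z i) = a z i • b z i) {N q : ℕ} (hq : q ≤ N) :
    ∑ z, ∑ i, a z i ^ (2 * q) ≤ (2 * N * V) ^ q * (Fintype.card ι * Fintype.card Z) := by
  induction q with
  | zero => simp [mul_comm]
  | succ q ih =>
    have ih := ih (by omega)
    have h := moment_succ_le hτ hX hα hB b hb q
    have h0 : 0 ≤ ∑ z, ∑ i, a z i ^ (2 * q) :=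
      Finset.sum_nonneg fun z _ => Finset.sum_nonneg fun i _ => (even_two_mul q).pow_nonneg _
    have h' : ∑ z, ∑ i, a z i ^ (2 * (q + 1)) ≤ (2 * q + 1) * V * ∑ z, ∑ i, a z i ^ (2 * q) := by
      refine le_of_mul_le_mul_left (h.trans (le_of_eq ?_)) hα0
      ring
    have hqN : (2 * q + 1 : ℝ) ≤ 2 * N := by
      have : ((q + 1 : ℕ) : ℝ) ≤ N := by exact_mod_cast hq
      push_cast at this
      linarith
    calc _ ≤ (2 * N) * V * ∑ z, ∑ i, a z i ^ (2 * q) := h'.trans (by gcongr)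
      _ ≤ (2 * N) * V * ((2 * N * V) ^ q * (Fintype.card ι * Fintype.card Z)) := by gcongr
      _ = _ := by ring

end Moments

/-- Tail bound at level `1 / p` for the uniform distribution on `Z`: Markov's inequality for the
moment of order `2 N`, where `N = ⌈log p⌉`. -/
theorem card_norm_gt_mul_le {E : Type*} [NormedAddCommGroup E] [InnerProductSpace ℝ E]
    [FiniteDimensional ℝ E] {p : ℕ} (hE : Module.finrank ℝ E = p) (hp : 3 ≤ p) {Z J : Type*} [Fintype Z] [Fintype J]
    {τ : J → Z → Z} (hτ : ∀ F : Z → Z → ℝ, ∑ z, ∑ j, F z (τ j z) = ∑ z, ∑ j, F (τ j z) z)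
    {X : Z → E →L[ℝ] E} (hX : ∀ z, (X z : E →ₗ[ℝ] E).IsSymmetric) {α V s : ℝ}
    (hα0 : 0 < α) (hV : 0 < V) (hα : ∀ z, ∑ j, (X z - X (τ j z)) = α • X z)
    (hB : ∀ z, ∑ j, ‖X z - X (τ j z)‖ ^ 2 ≤ α * V) (hs : 0 ≤ s)
    (hsV : 36 * V * Real.log p ≤ s ^ 2) [DecidablePred fun z => s < ‖X z‖] :
    ((Finset.univ.filter fun z => s < ‖X z‖).card : ℝ) * p ≤ Fintype.card Z := by
  have hp0 : (0 : ℝ) < p := by positivity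
  -- `log p ≥ 1` absorbs the rounding in `N`; this is where `p ≥ 3` is used.
  have hlog : 1 ≤ Real.log p := by
    rw [Real.le_log_iff_exp_le hp0]
    have : (3 : ℝ) ≤ p := by exact_mod_cast hp
    linarith [Real.exp_one_lt_d9]
  set N := ⌈Real.log p⌉₊ with hN
  have hN1 : Real.log p ≤ N := Nat.le_ceil _
  have hN2 : (N : ℝ) ≤ 2 * Real.log p := by
    linarith [Nat.ceil_lt_add_one (zero_le_one.trans hlog)]
  have hN0 : (0 : ℝ) < N := by linarith
  set b : Z → OrthonormalBasis (Fin p) ℝ (E) := fun z =>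
    (hX z).eigenvectorBasis hE with hbdef
  set a : Z → Fin p → ℝ := fun z => (hX z).eigenvalues hE with hadef
  have hb : ∀ z i, X z (b z i) = a z i • b z i := fun z i =>
    (hX z).apply_eigenvectorBasis hE i
  have hmom := moment_le hτ hX hα0 hV.le hα hB b hb (le_refl N)
  have hmarkov : ((Finset.univ.filter fun z => s < ‖X z‖).card : ℝ) * (s ^ 2) ^ N ≤
      ∑ z, ∑ i, a z i ^ (2 * N) := by
    rw [← nsmul_eq_mul, ← Finset.sum_const]
    refine (Finset.sum_le_sum fun z hz => ?_).trans
      (Finset.sum_le_sum_of_subset_of_nonneg (Finset.filter_subset _ _) fun z _ _ =>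
        Finset.sum_nonneg fun i _ => (even_two_mul N).pow_nonneg _)
    have hz' : s < ‖X z‖ := (Finset.mem_filter.1 hz).2
    obtain ⟨i, hi⟩ : ∃ i, s < |a z i| := by
      by_contra! hcon
      exact absurd (norm_le_of_eigenbasis (b z) (a z) (X z) (hb z) hs hcon) (not_le.2 hz')
    calc (s ^ 2) ^ N ≤ (|a z i| ^ 2) ^ N := by gcongr
      _ = a z i ^ (2 * N) := by rw [sq_abs, pow_mul]
      _ ≤ _ := Finset.single_le_sum (f := fun i => a z i ^ (2 * N))
          (fun i _ => (even_two_mul N).pow_nonneg _) (Finset.mem_univ i)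
  set D : ℝ := ((Finset.univ.filter fun z => s < ‖X z‖).card : ℝ) with hD
  have hD0 : 0 ≤ D := by positivity
  -- One factor `p` pays for the number of eigenvalues, the other one gives the probability `1 / p`.
  have hexp : (p : ℝ) ^ 2 ≤ (9 : ℝ) ^ N := by
    have h1 : (p : ℝ) ≤ 3 ^ N := by
      calc (p : ℝ) = Real.exp (Real.log p) := (Real.exp_log hp0).symm
        _ ≤ Real.exp N := Real.exp_le_exp.2 hN1
        _ = Real.exp 1 ^ N := by rw [← Real.exp_nat_mul, mul_one]
        _ ≤ 3 ^ N := by gcongr; linarith [Real.exp_one_lt_d9]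
    calc (p : ℝ) ^ 2 ≤ (3 ^ N) ^ 2 := by gcongr
      _ = 9 ^ N := by rw [← pow_mul, mul_comm, pow_mul]; norm_num
  have hscale : (9 : ℝ) ^ N * (2 * N * V) ^ N ≤ (s ^ 2) ^ N := by
    rw [← mul_pow]
    gcongr
    nlinarith
  have hA : 0 < (2 * N * V) ^ N := by positivity
  have hfin : D * (p : ℝ) ^ 2 * (2 * N * V) ^ N ≤ p * Fintype.card Z * (2 * N * V) ^ N := by
    calc D * (p : ℝ) ^ 2 * (2 * N * V) ^ N ≤ D * 9 ^ N * (2 * N * V) ^ N := by gcongr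
      _ = D * (9 ^ N * (2 * N * V) ^ N) := by ring
      _ ≤ D * (s ^ 2) ^ N := by gcongr
      _ ≤ _ := hmarkov.trans hmom
      _ = _ := by rw [Fintype.card_fin]; ring
  have := le_of_mul_le_mul_right hfin hA
  refine le_of_mul_le_mul_left (?_ : (p : ℝ) * (D * p) ≤ p * Fintype.card Z) hp0
  linarith [this, show (p : ℝ) * (D * p) = D * (p : ℝ) ^ 2 by ring]

/-! ### Concentration of sample means of symmetric operators -/

/-- Moves coming from an involution of `Z × J` are reversible. -/
theorem sum_move_comm {Z J : Type*} [Fintype Z] [Fintype J] {g : Z × J → Z × J}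
    (hg : Function.Involutive g) (F : Z → Z → ℝ) :
    ∑ z, ∑ j, F z (g (z, j)).1 = ∑ z, ∑ j, F (g (z, j)).1 z := by
  rw [← Fintype.sum_prod_type' fun z j => F z (g (z, j)).1,
    ← Fintype.sum_prod_type' fun z j => F (g (z, j)).1 z, ← Equiv.sum_comp (hg.toPerm g)]
  refine Finset.sum_congr rfl fun x _ => ?_
  simp [hg x]

variable {E : Type*} [NormedAddCommGroup E] [InnerProductSpace ℝ E] {n p : ℕ}

/-- The average of the operators `H i` over a sample `S`, counted with multiplicity. -/
noncomputable def sampleMean (H : Fin n → E →L[ℝ] E) (S : Multiset (Fin n)) : E →L[ℝ] E :=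
  (1 / (Multiset.card S : ℝ)) • (S.map H).sum



theorem sampleMean_univ (H : Fin n → E →L[ℝ] E) :
    sampleMean H Finset.univ.val = (1 / (n : ℝ)) • ∑ i, H i := by
  simp [sampleMean, Finset.sum]

theorem sum_isSymmetric {κ : Type*} (s : Finset κ) {H : κ → E →L[ℝ] E}
    (hH : ∀ i ∈ s, (H i : E →ₗ[ℝ] E).IsSymmetric) :
    ((∑ i ∈ s, H i : E →L[ℝ] E) : E →ₗ[ℝ] E).IsSymmetric := by
  intro x y
  simp only [ContinuousLinearMap.coe_coe, sum_apply, sum_inner, inner_sum]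
  exact Finset.sum_congr rfl fun i hi => hH i hi x y

section Centred

variable {H : Fin n → E →L[ℝ] E} {K : ℝ}

theorem sum_sub_sampleMean_univ [NeZero n] (H : Fin n → E →L[ℝ] E) :
    ∑ i, (H i - sampleMean H Finset.univ.val) = 0 := by
  have hn : (n : ℝ) ≠ 0 := by exact_mod_cast NeZero.ne n
  rw [Finset.sum_sub_distrib, sampleMean_univ, Finset.sum_const, Finset.card_univ,
    Fintype.card_fin, ← Nat.cast_smul_eq_nsmul ℝ, smul_smul, mul_one_div_cancel hn, one_smul,
    sub_self]

theorem isSymmetric_sub_sampleMean (hH : ∀ i, (H i : E →ₗ[ℝ] E).IsSymmetric)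
    (i : Fin n) :
    ((H i - sampleMean H Finset.univ.val : E →L[ℝ] E) : E →ₗ[ℝ] E).IsSymmetric := by
  have h := sum_isSymmetric Finset.univ fun i _ => hH i
  intro x y
  have h1 := hH i x y
  have h2 := h x y
  rw [sampleMean_univ]
  simp only [ContinuousLinearMap.coe_coe, sub_apply, smul_apply, inner_sub_left, inner_sub_right,
    real_inner_smul_left, real_inner_smul_right] at h1 h2 ⊢
  rw [h1, h2]

theorem norm_sub_sq_le (hK : ∀ i, ‖H i‖ ≤ K) (i j : Fin n) : ‖H i - H j‖ ^ 2 ≤ 4 * K ^ 2 := by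
  have h : ‖H i - H j‖ ≤ 2 * K := by linarith [norm_sub_le (H i) (H j), hK i, hK j]
  calc ‖H i - H j‖ ^ 2 ≤ (2 * K) ^ 2 := by gcongr
    _ = 4 * K ^ 2 := by ring

theorem smul_sampleMean_sub {m : ℕ} (hm : 1 ≤ m) (T : Multiset (Fin n))
    (hT : Multiset.card T = m) (B : E →L[ℝ] E) :
    (m : ℝ) • (sampleMean H T - B) = (T.map fun i => H i - B).sum := by
  have hm0 : (m : ℝ) ≠ 0 := by positivity
  rw [Multiset.sum_map_sub, Multiset.map_const', Multiset.sum_replicate, hT, smul_sub,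
    sampleMean, hT, smul_smul, mul_one_div_cancel hm0, one_smul, Nat.cast_smul_eq_nsmul]

/-- The samples whose mean is further than `12 K √(log p / m)` from the population mean. The size of the
sample is not part of the definition: a uniform sample of size `m` has it almost surely. -/
def deviating (p : ℕ) (H : Fin n → E →L[ℝ] E) (K : ℝ) (m : ℕ) : Set (Multiset (Fin n)) :=
  {T | 12 * K * Real.sqrt (Real.log p / m) < ‖sampleMean H T - sampleMean H Finset.univ.val‖}

theorem lt_norm_sum_of_mem_deviating {m : ℕ} (hm : 1 ≤ m) {T : Multiset (Fin n)}
    (hcard : Multiset.card T = m) (hT : T ∈ deviating p H K m) :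
    m * (12 * K * Real.sqrt (Real.log p / m)) <
      ‖(T.map fun i => H i - sampleMean H Finset.univ.val).sum‖ := by
  have hm0 : (0 : ℝ) < m := by positivity
  rw [← smul_sampleMean_sub hm T hcard, norm_smul, Real.norm_of_nonneg hm0.le]
  exact mul_lt_mul_of_pos_left hT hm0

theorem threshold_sq {m : ℕ} (hm : 1 ≤ m) :
    36 * (4 * K ^ 2 * m) * Real.log p = (m * (12 * K * Real.sqrt (Real.log p / m))) ^ 2 := by
  have hm0 : (m : ℝ) ≠ 0 := by positivity
  have h0 : 0 ≤ Real.log p / m := div_nonneg (Real.log_natCast_nonneg p) (Nat.cast_nonneg m)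
  rw [mul_pow, mul_pow, Real.sq_sqrt h0]
  field_simp
  ring

open Classical in
theorem card_deviating_withReplacement [FiniteDimensional ℝ E] [NeZero n] (hE : Module.finrank ℝ E = p) (hp : 3 ≤ p)
    (hH : ∀ i, (H i : E →ₗ[ℝ] E).IsSymmetric) (hK0 : 0 < K) (hK : ∀ i, ‖H i‖ ≤ K)
    {m : ℕ} (hm : 1 ≤ m) :
    ((Finset.univ.filter fun z : Fin m → Fin n =>
      Finset.univ.val.map z ∈ deviating p H K m).card : ℝ) * p ≤ Fintype.card (Fin m → Fin n) := by
  have hn0 : (0 : ℝ) < n := by exact_mod_cast NeZero.pos n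
  have hm0 : (0 : ℝ) < m := by positivity
  set A : Fin n → E →L[ℝ] E := fun i => H i - sampleMean H Finset.univ.val with hA
  have hA0 : ∑ i, A i = 0 := sum_sub_sampleMean_univ H
  -- The move `(k, v)` replaces the `k`-th draw by `v`; the old value undoes it.
  let g : (Fin m → Fin n) × (Fin m × Fin n) → (Fin m → Fin n) × (Fin m × Fin n) :=
    fun x => (Function.update x.1 x.2.1 x.2.2, (x.2.1, x.1 x.2.1))
  have hg : Function.Involutive g := by
    rintro ⟨z, k, v⟩
    simp [g]
  have hdiff : ∀ (z : Fin m → Fin n) (j : Fin m × Fin n),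
      ∑ k, A (z k) - ∑ k, A ((g (z, j)).1 k) = H (z j.1) - H j.2 := by
    intro z j
    rw [← Finset.sum_sub_distrib, Finset.sum_eq_single j.1]
    · simp [g, hA]
    · intro k _ hk
      simp [g, hk]
    · simp
  have key := card_norm_gt_mul_le hE hp (τ := fun j z => (g (z, j)).1) (sum_move_comm hg)
    (X := fun z => ∑ k, A (z k))
    (fun z => sum_isSymmetric _ fun k _ => isSymmetric_sub_sampleMean hH (z k))
    (α := n) (V := 4 * K ^ 2 * m) (s := m * (12 * K * Real.sqrt (Real.log p / m)))
    hn0 (by positivity) ?_ ?_ (by positivity) (threshold_sq hm).le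
  · refine le_trans ?_ key
    gcongr with z _
    intro hz
    exact lt_norm_sum_of_mem_deviating hm (by simp) hz |>.trans_eq (by simp [hA, Finset.sum, Function.comp_def])
  · intro z
    simp_rw [hdiff]
    have hHA : ∀ i j, H i - H j = A i - A j := fun i j => by simp [hA]
    simp_rw [hHA, Fintype.sum_prod_type, Finset.sum_sub_distrib, hA0]
    simp [Finset.smul_sum, Nat.cast_smul_eq_nsmul]
  · intro z
    simp_rw [hdiff]
    refine (Finset.sum_le_card_nsmul _ _ _ fun j _ => norm_sub_sq_le hK _ _).trans (le_of_eq ?_)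
    simp
    ring

open Classical in
theorem card_deviating_withoutReplacement [FiniteDimensional ℝ E] [NeZero n] (hE : Module.finrank ℝ E = p) (hp : 3 ≤ p)
    (hH : ∀ i, (H i : E →ₗ[ℝ] E).IsSymmetric) (hK0 : 0 < K) (hK : ∀ i, ‖H i‖ ≤ K)
    {m : ℕ} (hm : 1 ≤ m) :
    (((Finset.powersetCard m (Finset.univ : Finset (Fin n))).filter fun T =>
      T.val ∈ deviating p H K m).card : ℝ) * p ≤
        (Finset.powersetCard m (Finset.univ : Finset (Fin n))).card := by
  have hn0 : (0 : ℝ) < n := by exact_mod_cast NeZero.pos n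
  have hm0 : (0 : ℝ) < m := by positivity
  set A : Fin n → E →L[ℝ] E := fun i => H i - sampleMean H Finset.univ.val with hA
  have hA0 : ∑ i, A i = 0 := sum_sub_sampleMean_univ H
  let Z := {T : Finset (Fin n) // T ∈ Finset.powersetCard m (Finset.univ : Finset (Fin n))}
  have hZ : ∀ T : Z, T.1.card = m := fun T => (Finset.mem_powersetCard_univ.1 T.2)
  -- The move `(i, j)` transposes `i` and `j`; it fixes the subset unless exactly one of them belongs to it.
  let g : Z × (Fin n × Fin n) → Z × (Fin n × Fin n) := fun x =>
    (⟨x.1.1.map (Equiv.swap x.2.1 x.2.2).toEmbedding, by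
      rw [Finset.mem_powersetCard_univ, Finset.card_map, hZ]⟩, x.2)
  have hg : Function.Involutive g := by
    rintro ⟨T, i, j⟩
    refine Prod.ext (Subtype.ext ?_) rfl
    ext k
    simp [g, Finset.mem_map_equiv]
  -- The indicator function of the subset.
  let t : Z → Fin n → ℝ := fun T i => if i ∈ T.1 then 1 else 0
  have hdiff : ∀ (T : Z) (x : Fin n × Fin n),
      ∑ k ∈ T.1, A k - ∑ k ∈ (g (T, x)).1.1, A k =
        (t T x.1 - t T x.2) • (H x.1 - H x.2) := by
    rintro T ⟨i, j⟩
    have hk : ∀ k, A k - A (Equiv.swap i j k) =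
        ((if k = i then (1 : ℝ) else 0) - (if k = j then 1 else 0)) • (H i - H j) := by
      intro k
      rcases eq_or_ne k i with rfl | h1
      · rcases eq_or_ne k j with rfl | h2 <;> simp [*]
      · rcases eq_or_ne k j with rfl | h2
        · rw [Equiv.swap_apply_right, if_neg h1, if_pos rfl, zero_sub, neg_smul, one_smul,
            neg_sub]
          simp only [hA, sub_sub_sub_cancel_right]
        · rw [Equiv.swap_apply_of_ne_of_ne h1 h2, if_neg h1, if_neg h2, sub_self, sub_self,
            zero_smul]
    simp only [g, Finset.sum_map, Equiv.coe_toEmbedding]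
    rw [← Finset.sum_sub_distrib]
    simp_rw [hk, ← Finset.sum_smul, Finset.sum_sub_distrib, Finset.sum_ite_eq', t]
  have hsumt : ∀ T : Z, ∑ i, t T i = m := by
    intro T
    simp [t, hZ]
  have key := card_norm_gt_mul_le hE hp (τ := fun j z => (g (z, j)).1) (sum_move_comm hg)
    (X := fun T => ∑ k ∈ T.1, A k)
    (fun z => sum_isSymmetric _ fun k _ => isSymmetric_sub_sampleMean hH k)
    (α := 2 * n) (V := 4 * K ^ 2 * m) (s := m * (12 * K * Real.sqrt (Real.log p / m)))
    (by positivity) (by positivity) ?_ ?_ (by positivity) (threshold_sq hm).le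
  · have hcard : Fintype.card Z = (Finset.powersetCard m (Finset.univ : Finset (Fin n))).card :=
      Fintype.card_coe _
    rw [hcard] at key
    refine le_trans ?_ key
    gcongr
    refine Finset.card_le_card_of_surjOn Subtype.val fun T hT => ?_
    obtain ⟨hT1, hT2⟩ := Finset.mem_filter.1 (Finset.mem_coe.1 hT)
    refine ⟨⟨T, hT1⟩, ?_, rfl⟩
    simp only [Finset.coe_filter, Finset.mem_univ, true_and, Set.mem_ofPred_eq]
    exact lt_norm_sum_of_mem_deviating hm (hZ ⟨T, hT1⟩) hT2
  · intro T
    simp_rw [hdiff]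
    have hHA : ∀ i j, H i - H j = A i - A j := fun i j => by simp [hA]
    have hX : ∑ k ∈ T.1, A k = ∑ k, t T k • A k := by
      simp only [t, ite_smul, one_smul, zero_smul, Finset.sum_ite_mem, Finset.univ_inter]
    simp_rw [hHA, Fintype.sum_prod_type, sub_smul, smul_sub, Finset.sum_sub_distrib,
      ← Finset.smul_sum, hA0, hX, mul_smul, two_smul]
    rw [Finset.sum_comm (f := fun i j => t T j • A i)]
    simp_rw [← Finset.smul_sum, hA0]
    simp only [Finset.sum_const, Finset.card_univ, Fintype.card_fin, sub_zero, zero_sub,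
      sub_neg_eq_add, smul_zero, ← Nat.cast_smul_eq_nsmul ℝ, smul_comm _ (n : ℝ), ← Finset.smul_sum]
  · intro T
    simp_rw [hdiff]
    have hle : ∀ x : Fin n × Fin n, ‖(t T x.1 - t T x.2) • (H x.1 - H x.2)‖ ^ 2 ≤
        (t T x.1 + t T x.2) * (4 * K ^ 2) := by
      intro x
      rw [norm_smul, mul_pow, Real.norm_eq_abs, sq_abs]
      refine mul_le_mul ?_ (norm_sub_sq_le hK _ _) (by positivity) ?_
      all_goals
        simp only [t]
        split_ifs <;> norm_num
    refine (Finset.sum_le_sum fun x _ => hle x).trans (le_of_eq ?_)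
    rw [← Finset.sum_mul, Fintype.sum_prod_type]
    simp_rw [Finset.sum_add_distrib, hsumt]
    simp [← Finset.mul_sum, hsumt]
    ring

theorem ofNat_div_le_inv {a b p : ℕ} (h : (a : ℝ) * p ≤ b) :
    (a : ENNReal) / b ≤ (p : ENNReal)⁻¹ := by
  have h' : a * p ≤ b := by exact_mod_cast h
  rw [ENNReal.le_inv_iff_mul_le, ← ENNReal.mul_div_right_comm]
  exact ENNReal.div_le_of_le_mul (by rw [one_mul]; exact_mod_cast h')

theorem deviating_eq_empty (hK : ∀ i, ‖H i‖ ≤ 0) (m : ℕ) :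
    deviating p H 0 m = ∅ := by
  have h0 : H = 0 := funext fun i => norm_le_zero_iff.1 (hK i)
  ext T
  simp [deviating, sampleMean, h0]

theorem map_deviating_le [FiniteDimensional ℝ E] [NeZero n] {Ω : Type*} [MeasurableSpace Ω] {μ : Measure Ω} {m : ℕ}
    {S : Ω → Multiset (Fin n)} (hS : IsUniformSample μ m S) (hE : Module.finrank ℝ E = p) (hp : 3 ≤ p)
    (hH : ∀ i, (H i : E →ₗ[ℝ] E).IsSymmetric) (hK : ∀ i, ‖H i‖ ≤ K)
    (hm : 1 ≤ m) : μ.map S (deviating p H K m) ≤ (p : ENNReal)⁻¹ := by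
  classical
  have hK0 : 0 ≤ K := (norm_nonneg _).trans (hK 0)
  rcases hK0.eq_or_lt with rfl | hK0
  · simp [deviating_eq_empty hK]
  have hmeas : MeasurableSet (deviating p H K m) := trivial
  -- Both laws are images of uniform laws, whose underlying types carry the discrete σ-algebra here.
  rcases hS.2 with h | ⟨hmn, h⟩
  · let _ : MeasurableSpace (Fin m → Fin n) := ⊤
    rw [h, withReplacement, PMF.toMeasure_map_apply _ _ _ measurable_from_top hmeas,
      PMF.toMeasure_uniformOfFintype_apply _ MeasurableSpace.measurableSet_top]
    refine ofNat_div_le_inv ?_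
    refine le_trans (le_of_eq ?_) (card_deviating_withReplacement hE hp hH hK0 hK hm)
    congr 2
    rw [Fintype.card_subtype]
    rfl
  · let _ : MeasurableSpace (Finset (Fin n)) := ⊤
    rw [h, withoutReplacement, PMF.toMeasure_map_apply _ _ _ measurable_from_top hmeas,
      PMF.toMeasure_uniformOfFinset_apply _ _ MeasurableSpace.measurableSet_top]
    refine ofNat_div_le_inv ?_
    refine le_trans (le_of_eq ?_) (card_deviating_withoutReplacement hE hp hH hK0 hK hm)
    rfl

end Centred

/-! ### Projections, Hessians and the Taylor remainder -/

theorem subHessian_eq_sampleMean {n p : ℕ} (f : Fin n → Param p → ℝ) (S : Multiset (Fin n))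
    (θ : Param p) : subHessian f S θ = sampleMean (fun i => hessian (f i) θ) S := rfl

section Projection

variable {p : ℕ} {C : Set (Param p)} {x y z : Param p}

theorem IsProjection.inner_le_zero (h : IsProjection C x y) (hC : Convex ℝ C) (hz : z ∈ C) :
    inner ℝ (x - y) (z - y) ≤ 0 := by
  refine (norm_eq_iInf_iff_real_inner_le_zero hC h.1).1 (le_antisymm ?_ ?_) z hz
  · have : Nonempty C := ⟨⟨y, h.1⟩⟩
    exact le_ciInf fun w => h.2 w w.2
  · exact ciInf_le (f := fun w : C => ‖x - w‖) ⟨0, by rintro _ ⟨w, rfl⟩; positivity⟩ ⟨y, h.1⟩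

theorem IsProjection.norm_sub_le (h : IsProjection C x y) (hC : Convex ℝ C) (hz : z ∈ C) :
    ‖y - z‖ ≤ ‖x - z‖ := by
  have h0 := h.inner_le_zero hC hz
  have h1 := norm_sub_sq_real (x - y) (z - y)
  rw [sub_sub_sub_cancel_right, norm_sub_rev z y] at h1
  refine le_of_sq_le_sq ?_ (norm_nonneg _)
  nlinarith [sq_nonneg ‖x - y‖]

theorem IsProjection.unique (h : IsProjection C x y) (h' : IsProjection C x z)
    (hC : Convex ℝ C) : y = z := by
  have h1 := h.inner_le_zero hC h'.1
  have h2 := h'.inner_le_zero hC h.1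
  have h3 : inner ℝ (y - z) (y - z) = inner ℝ (x - y) (z - y) + inner ℝ (x - z) (y - z) := by
    rw [← neg_sub y z, inner_neg_right, neg_add_eq_sub, ← inner_sub_left, sub_sub_sub_cancel_left]
  exact sub_eq_zero.1 (real_inner_self_nonpos.1 (h3.trans_le (by linarith)))

end Projection

section Hessian

variable {n p : ℕ} {g : Param p → ℝ} {θ : Param p}

theorem hasFDerivAt_gradient (hg : ContDiffAt ℝ 2 g θ) :
    HasFDerivAt (gradient g) (hessian g θ) θ := by
  refine DifferentiableAt.hasFDerivAt (differentiableAt_euclidean.2 fun i => ?_)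
  have h1 : DifferentiableAt ℝ (fderiv ℝ g) θ :=
    (hg.fderiv_right (m := 1) (by norm_num)).differentiableAt one_ne_zero
  have h2 : (fun x => gradient g x i) = fun x => fderiv ℝ g x (EuclideanSpace.single i 1) := by
    funext x
    rw [← inner_gradient_left, EuclideanSpace.inner_single_right]
    simp
  rw [h2]
  exact h1.clm_apply (differentiableAt_const _)

theorem inner_hessian_apply (hg : ContDiffAt ℝ 2 g θ) (u v : Param p) :
    inner ℝ (hessian g θ u) v = fderiv ℝ (fderiv ℝ g) θ u v := by
  have h1 : DifferentiableAt ℝ (fderiv ℝ g) θ :=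
    (hg.fderiv_right (m := 1) (by norm_num)).differentiableAt one_ne_zero
  have h2 := (hasFDerivAt_gradient hg).inner ℝ (hasFDerivAt_const v θ)
  have h3 := h1.hasFDerivAt.clm_apply (hasFDerivAt_const v θ)
  have h4 : (fun x => inner ℝ (gradient g x) v) = fun x => fderiv ℝ g x v :=
    funext fun x => inner_gradient_left
  rw [h4] at h2
  have h5 := congrArg (fun L => L u) (h2.unique h3)
  simpa using h5

theorem isSymmetric_hessian (hg : ContDiffAt ℝ 2 g θ) :
    (hessian g θ : Param p →ₗ[ℝ] Param p).IsSymmetric := by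
  intro u v
  simp only [ContinuousLinearMap.coe_coe]
  rw [inner_hessian_apply hg, real_inner_comm, inner_hessian_apply hg]
  exact hg.isSymmSndFDerivAt (by simp) u v

theorem hasFDerivAt_gradient_objective {f : Fin n → Param p → ℝ}
    (hf : ∀ i, ContDiffAt ℝ 2 (f i) θ) :
    HasFDerivAt (gradient (objective f)) (subHessian f Finset.univ.val θ) θ := by
  have hev : gradient (objective f) =ᶠ[nhds θ]
      fun x => (1 / (n : ℝ)) • ∑ i, gradient (f i) x := by
    have h : ∀ᶠ x in nhds θ, ∀ i, ContDiffAt ℝ 2 (f i) x :=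
      Filter.eventually_all.2 fun i => (hf i).eventually (by simp)
    filter_upwards [h] with x hx
    refine ext_inner_right ℝ fun v => ?_
    have h1 : HasFDerivAt (objective f) ((1 / (n : ℝ)) • ∑ i, fderiv ℝ (f i) x) x :=
      (HasFDerivAt.fun_sum fun i _ =>
        ((hx i).differentiableAt two_ne_zero).hasFDerivAt).const_mul (1 / (n : ℝ))
    rw [inner_gradient_left, h1.fderiv, real_inner_smul_left, sum_inner]
    simp [inner_gradient_left]
  rw [subHessian_eq_sampleMean, sampleMean_univ]
  exact ((HasFDerivAt.fun_sum fun i _ => hasFDerivAt_gradient (hf i)).const_smul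
    (1 / (n : ℝ))).congr_of_eventuallyEq hev

end Hessian

/-- First-order Taylor remainder for a map whose derivative is Lipschitz on a convex set. -/
theorem norm_sub_sub_apply_le {E F : Type*} [NormedAddCommGroup E] [NormedSpace ℝ E]
    [NormedAddCommGroup F] [NormedSpace ℝ F] {C : Set E} (hC : Convex ℝ C) {G : E → F}
    {D : E → E →L[ℝ] F} (hG : ∀ x ∈ C, HasFDerivAt G (D x) x) {M : ℝ}
    (hM : ∀ x ∈ C, ∀ y ∈ C, ‖D x - D y‖ ≤ M * ‖x - y‖) {x y : E} (hx : x ∈ C) (hy : y ∈ C) :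
    ‖G y - G x - D x (y - x)‖ ≤ M / 2 * ‖y - x‖ ^ 2 := by
  set γ : ℝ → E := fun τ => x + τ • (y - x) with hγ
  have hγC : ∀ τ ∈ Set.Icc (0 : ℝ) 1, γ τ ∈ C := fun τ hτ => hC.add_smul_sub_mem hx hy hτ
  have hγ' : ∀ τ, HasDerivAt γ (y - x) τ := fun τ => by
    have h := ((hasDerivAt_id τ).smul_const (y - x)).const_add x
    rwa [one_smul] at h
  have hg : ∀ τ ∈ Set.Icc (0 : ℝ) 1, HasDerivAt (fun τ => G (γ τ) - G x - τ • D x (y - x))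
      ((D (γ τ) - D x) (y - x)) τ := fun τ hτ => by
    have h1 := ((hG _ (hγC τ hτ)).comp_hasDerivAt τ (hγ' τ)).sub_const (G x)
    have h2 := h1.sub ((hasDerivAt_id τ).smul_const (D x (y - x)))
    rwa [one_smul, ← sub_apply] at h2
  have hB : ∀ τ, HasDerivAt (fun τ : ℝ => M / 2 * ‖y - x‖ ^ 2 * τ ^ 2)
      (M * ‖y - x‖ ^ 2 * τ) τ := fun τ => by
    refine ((hasDerivAt_pow 2 τ).const_mul (M / 2 * ‖y - x‖ ^ 2)).congr_deriv ?_
    norm_num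
    ring
  have h := image_norm_le_of_norm_deriv_right_le_deriv_boundary
    (fun τ hτ => (hg τ hτ).continuousAt.continuousWithinAt)
    (fun τ hτ => (hg τ (Set.Ico_subset_Icc_self hτ)).hasDerivWithinAt) (by simp [hγ]) hB
    (fun τ hτ => ?_) (Set.right_mem_Icc.2 zero_le_one)
  · simpa [hγ] using h
  · have h1 := hM _ (hγC τ (Set.Ico_subset_Icc_self hτ)) x hx
    have h2 : ‖γ τ - x‖ = τ * ‖y - x‖ := by
      simp [hγ, norm_smul, abs_of_nonneg hτ.1]
    calc ‖(D (γ τ) - D x) (y - x)‖ ≤ ‖D (γ τ) - D x‖ * ‖y - x‖ :=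
          ContinuousLinearMap.le_opNorm _ _
      _ ≤ M * (τ * ‖y - x‖) * ‖y - x‖ := by rw [← h2]; gcongr
      _ = M * ‖y - x‖ ^ 2 * τ := by ring

/-! ### The thresholded inverse and one step of the algorithm -/

section ThresholdedInverse

variable {p r : ℕ} {T : Op p}

/-- `eigval` takes the value `0` at operators that are not symmetric. -/
theorem isSymmetric_of_eigval_pos {k : ℕ} (h : 0 < eigval T k) :
    (T : Param p →ₗ[ℝ] Param p).IsSymmetric := by
  by_contra hT
  rw [eigval, dif_neg fun h' => hT h'.1] at h
  exact lt_irrefl _ h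

/-- `eigval` counts from `1`, Mathlib's eigenvalues from `0`. -/
theorem eigval_succ (hT : (T : Param p →ₗ[ℝ] Param p).IsSymmetric) {k : ℕ} (hk : k < p) :
    eigval T (k + 1) = hT.eigenvalues finrank_euclideanSpace_fin ⟨k, hk⟩ := by
  rw [eigval, dif_pos ⟨hT, by omega, by omega⟩]
  rfl

theorem eigvec_succ (hT : (T : Param p →ₗ[ℝ] Param p).IsSymmetric) {k : ℕ} (hk : k < p) :
    eigvec T (k + 1) = hT.eigenvectorBasis finrank_euclideanSpace_fin ⟨k, hk⟩ := by
  rw [eigvec, dif_pos ⟨hT, by omega, by omega⟩]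
  rfl

theorem thresholdedInverse_apply_eigenvector (hT : (T : Param p →ₗ[ℝ] Param p).IsSymmetric)
    (hr : r + 1 ≤ p) (i : Fin p) :
    thresholdedInverse r T (hT.eigenvectorBasis finrank_euclideanSpace_fin i) =
      (if (i : ℕ) < r then (eigval T (i + 1))⁻¹ else (eigval T (r + 1))⁻¹) •
        hT.eigenvectorBasis finrank_euclideanSpace_fin i := by
  set b := hT.eigenvectorBasis finrank_euclideanSpace_fin with hb
  have hterm : ∀ k ∈ Finset.range r, inner ℝ (eigvec T (1 + k)) (b i) =
      if k = (i : ℕ) then (1 : ℝ) else 0 := by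
    intro k hk
    have hk' := Finset.mem_range.1 hk
    rw [add_comm, eigvec_succ hT (by omega : k < p), ← hb, b.inner_eq_ite]
    simp [Fin.ext_iff]
  have hexp : thresholdedInverse r T (b i) = (eigval T (r + 1))⁻¹ • b i +
      ∑ k ∈ Finset.Icc 1 r, ((eigval T k)⁻¹ - (eigval T (r + 1))⁻¹) •
        (inner ℝ (eigvec T k) (b i) : ℝ) • eigvec T k := by
    simp only [thresholdedInverse, add_apply, sum_apply, smul_apply,
      InnerProductSpace.rankOne_apply, ContinuousLinearMap.id_apply]
  have hsum : ∑ k ∈ Finset.Icc 1 r, ((eigval T k)⁻¹ - (eigval T (r + 1))⁻¹) •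
        (inner ℝ (eigvec T k) (b i) : ℝ) • eigvec T k =
      ∑ k ∈ Finset.range r, if k = (i : ℕ) then
        ((eigval T (k + 1))⁻¹ - (eigval T (r + 1))⁻¹) • b i else 0 := by
    rw [← Finset.Ico_add_one_right_eq_Icc, Finset.sum_Ico_eq_sum_range, Nat.add_sub_cancel]
    refine Finset.sum_congr rfl fun k hk => ?_
    rw [hterm k hk, add_comm 1 k]
    split_ifs with h
    · subst h
      rw [one_smul, eigvec_succ hT i.2]
    · rw [zero_smul, smul_zero]
  rw [hexp, hsum, Finset.sum_ite_eq']
  simp only [Finset.mem_range]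
  split_ifs with h
  · rw [← add_smul, add_sub_cancel]
  · rw [add_zero]

theorem eigval_succ_antitone (hT : (T : Param p →ₗ[ℝ] Param p).IsSymmetric) {k l : ℕ}
    (hkl : k ≤ l) (hl : l < p) : eigval T (l + 1) ≤ eigval T (k + 1) := by
  rw [eigval_succ hT hl, eigval_succ hT (hkl.trans_lt hl)]
  exact hT.eigenvalues_antitone finrank_euclideanSpace_fin hkl

theorem norm_thresholdedInverse_le (hr : r + 1 ≤ p) (hpos : 0 < eigval T (r + 1)) :
    ‖thresholdedInverse r T‖ ≤ (eigval T (r + 1))⁻¹ := by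
  have hT := isSymmetric_of_eigval_pos hpos
  refine norm_le_of_eigenbasis _ _ _ (thresholdedInverse_apply_eigenvector hT hr)
    (inv_nonneg.2 hpos.le) fun i => ?_
  split_ifs with h
  · have hle := eigval_succ_antitone hT h.le (by omega : r < p)
    rw [abs_of_pos (inv_pos.2 (hpos.trans_le hle))]
    exact inv_anti₀ hpos hle
  · rw [abs_of_pos (inv_pos.2 hpos)]

/-- In the eigenbasis of `T` the operator is diagonal with entries `1 - η x`, where `x` runs through
numbers between `λ_p / λ_{r+1}` and `1`; the step-size condition makes the first endpoint dominate. -/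
theorem norm_id_sub_thresholdedInverse_comp_le (hr : r + 1 ≤ p) (hpos : 0 < eigval T (r + 1))
    {η : ℝ} (hη0 : 0 ≤ η) (hη : η ≤ 2 / (1 + eigval T p / eigval T (r + 1))) :
    ‖ContinuousLinearMap.id ℝ (Param p) - η • (thresholdedInverse r T ∘L T)‖ ≤
      1 - η * (eigval T p / eigval T (r + 1)) := by
  have hT := isSymmetric_of_eigval_pos hpos
  set ρ := eigval T p / eigval T (r + 1) with hρ
  have hp : p - 1 + 1 = p := by omega
  have hρ1 : ρ ≤ 1 := by
    have h := eigval_succ_antitone hT (by omega : r ≤ p - 1) (by omega : p - 1 < p)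
    rw [hp] at h
    exact (div_le_one hpos).2 h
  have hηρ : η * (1 + ρ) ≤ 2 := by
    -- If `1 + ρ ≤ 0` the bound holds because `η ≥ 0`, whatever the value of the quotient in `hη`.
    rcases lt_or_ge 0 (1 + ρ) with h | h
    · exact (le_div_iff₀ h).1 hη
    · nlinarith
  have hpρ : 0 ≤ 1 - η * ρ := by nlinarith
  have hmain : ∀ x, ρ ≤ x → x ≤ 1 → |1 - η * x| ≤ 1 - η * ρ := by
    intro x h1 h2
    have h3 : η * ρ ≤ η * x := by gcongr
    have h4 : η * x ≤ η * 1 := by gcongr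
    rw [abs_le]
    constructor <;> linarith
  refine norm_le_of_eigenbasis (hT.eigenvectorBasis finrank_euclideanSpace_fin)
    (fun i => 1 - η * ((if (i : ℕ) < r then (eigval T (i + 1))⁻¹ else (eigval T (r + 1))⁻¹) *
      eigval T (i + 1))) _ (fun i => ?_) hpρ fun i => ?_
  · have hTi : T (hT.eigenvectorBasis finrank_euclideanSpace_fin i) =
        eigval T (i + 1) • hT.eigenvectorBasis finrank_euclideanSpace_fin i := by
      rw [eigval_succ hT i.2]
      exact hT.apply_eigenvectorBasis finrank_euclideanSpace_fin i
    simp only [sub_apply, smul_apply, ContinuousLinearMap.id_apply,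
      ContinuousLinearMap.comp_apply, hTi, map_smul, thresholdedInverse_apply_eigenvector hT hr]
    rw [sub_smul, one_smul, mul_smul, smul_smul (eigval T (i + 1)), mul_comm (eigval T (i + 1))]
  · split_ifs with h
    · have hle := eigval_succ_antitone hT h.le (by omega : r < p)
      rw [inv_mul_cancel₀ (hpos.trans_le hle).ne']
      exact hmain 1 hρ1 le_rfl
    · rw [inv_mul_eq_div]
      refine hmain _ ?_ ?_
      · have h1 := eigval_succ_antitone hT (by omega : (i : ℕ) ≤ p - 1) (by omega : p - 1 < p)
        rw [hp] at h1
        rw [hρ]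
        gcongr
      · exact (div_le_one hpos).2 (eigval_succ_antitone hT (not_lt.1 h) i.2)

end ThresholdedInverse

theorem norm_step_sub_le {p r : ℕ} {T H : Op p} (hr : r + 1 ≤ p) (hpos : 0 < eigval T (r + 1))
    {η : ℝ} (hη0 : 0 ≤ η) (hη : η ≤ 2 / (1 + eigval T p / eigval T (r + 1))) {ε R : ℝ}
    (hε : ‖T - H‖ ≤ ε) {x z v : Param p} (hv : ‖v - H (x - z)‖ ≤ R) :
    ‖x - η • thresholdedInverse r T v - z‖ ≤
      (1 - η * (eigval T p / eigval T (r + 1)) + η * (ε / eigval T (r + 1))) * ‖x - z‖ +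
        η * (R / eigval T (r + 1)) := by
  set Q := thresholdedInverse r T with hQ
  have hQn := norm_thresholdedInverse_le hr hpos
  have hI := norm_id_sub_thresholdedInverse_comp_le hr hpos hη0 hη
  rw [← hQ] at hQn hI
  have hsplit : x - η • Q v - z =
      (ContinuousLinearMap.id ℝ (Param p) - η • (Q ∘L T)) (x - z) +
        (η • Q ((T - H) (x - z)) - η • Q (v - H (x - z))) := by
    simp only [sub_apply, smul_apply, ContinuousLinearMap.id_apply,
      ContinuousLinearMap.comp_apply, map_sub, smul_sub]
    abel
  have h1 := ((ContinuousLinearMap.id ℝ (Param p) - η • (Q ∘L T)).le_opNorm (x - z)).trans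
    (mul_le_mul_of_nonneg_right hI (norm_nonneg _))
  have hQ' : ∀ (w : Param p) {B : ℝ}, ‖w‖ ≤ B → ‖η • Q w‖ ≤ η * (B / eigval T (r + 1)) := by
    intro w B hw
    rw [norm_smul, Real.norm_of_nonneg hη0, div_eq_inv_mul]
    exact mul_le_mul_of_nonneg_left ((Q.le_opNorm w).trans
      (mul_le_mul hQn hw (norm_nonneg _) (inv_nonneg.2 hpos.le))) hη0
  have h2 := hQ' ((T - H) (x - z)) (B := ε * ‖x - z‖)
    (((T - H).le_opNorm _).trans (mul_le_mul_of_nonneg_right hε (norm_nonneg _)))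
  have h3 := hQ' _ hv
  rw [hsplit]
  refine (norm_add_le _ _).trans ?_
  refine (add_le_add h1 ((norm_sub_le _ _).trans (add_le_add h2 h3))).trans (le_of_eq ?_)
  ring

/-! ### Dependence on the past and the convergence bound -/

theorem IsRun.mem {n p r : ℕ} {f : Fin n → Param p → ℝ} {C : Set (Param p)} {η : ℕ → ℝ}
    {S : ℕ → Multiset (Fin n)} {θ : ℕ → Param p} (h : IsRun f C r η S θ) (h0 : θ 0 ∈ C) :
    ∀ t, θ t ∈ C
  | 0 => h0
  | t + 1 => (h t).1

theorem IsRun.eq_of_samples_eq {n p r : ℕ} {f : Fin n → Param p → ℝ} {C : Set (Param p)}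
    (hC : Convex ℝ C) {η η' : ℕ → ℝ} {S S' : ℕ → Multiset (Fin n)} {θ θ' : ℕ → Param p}
    (h : IsRun f C r η S θ) (h' : IsRun f C r η' S' θ') (h0 : θ 0 = θ' 0) {t : ℕ}
    (hη : ∀ τ < t, η τ = η' τ) (hS : ∀ τ < t, S τ = S' τ) : θ t = θ' t := by
  induction t with
  | zero => exact h0
  | succ t ih =>
    have hθ := ih (fun τ hτ => hη τ (by omega)) (fun τ hτ => hS τ (by omega))
    have h1 := h t
    rw [hθ, hη t t.lt_succ_self, hS t t.lt_succ_self] at h1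
    exact h1.unique (h' t) hC

/-- If `B` depends on `ω` only through `Y`, and `X` is independent of `Y`, then the probability of
`X ∈ B` is at most any bound for the probabilities with `B` frozen. -/
theorem measurableSet_and_measure_le_of_indepFun {Ω 𝓧 𝓨 : Type*} [MeasurableSpace Ω]
    {μ : Measure Ω} [IsProbabilityMeasure μ] [MeasurableSpace 𝓧] [MeasurableSpace 𝓨]
    [Countable 𝓧] [Countable 𝓨] [MeasurableSingletonClass 𝓧] [MeasurableSingletonClass 𝓨]
    {X : Ω → 𝓧} {Y : Ω → 𝓨} (hX : Measurable X) (hY : Measurable Y) (hXY : IndepFun X Y μ)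
    {B : Ω → Set 𝓧} (hB : ∀ ω ω', Y ω = Y ω' → B ω = B ω') {ε : ENNReal}
    (hε : ∀ ω, μ.map X (B ω) ≤ ε) :
    MeasurableSet {ω | X ω ∈ B ω} ∧ μ {ω | X ω ∈ B ω} ≤ ε := by
  set D : Set (𝓨 × 𝓧) := {x | ∃ ω, Y ω = x.1 ∧ x.2 ∈ B ω} with hD
  have hDmeas : MeasurableSet D := D.to_countable.measurableSet
  have hpre : {ω | X ω ∈ B ω} = (fun ω => (Y ω, X ω)) ⁻¹' D := by
    ext ω
    refine ⟨fun h => ⟨ω, rfl, h⟩, fun ⟨ω', h1, h2⟩ => ?_⟩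
    have h3 := hB ω' ω h1
    rw [h3] at h2
    exact h2
  have hYX := hY.prodMk hX
  refine ⟨hpre ▸ hYX hDmeas, ?_⟩
  have := Measure.isProbabilityMeasure_map hX.aemeasurable (μ := μ)
  have := Measure.isProbabilityMeasure_map hY.aemeasurable (μ := μ)
  rw [hpre, ← Measure.map_apply hYX hDmeas,
    hXY.symm.map_prod_eq_prod_map_map hY.aemeasurable hX.aemeasurable,
    Measure.prod_apply hDmeas]
  calc ∫⁻ y, μ.map X (Prod.mk y ⁻¹' D) ∂μ.map Y ≤ ∫⁻ _, ε ∂μ.map Y := by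
        refine lintegral_mono fun y => ?_
        by_cases hy : ∃ ω, Y ω = y
        · obtain ⟨ω, rfl⟩ := hy
          refine (measure_mono fun x hx => ?_).trans (hε ω)
          obtain ⟨ω', h1, h2⟩ := hx
          exact hB ω' ω h1 ▸ h2
        · have : Prod.mk y ⁻¹' D = ∅ :=
            Set.eq_empty_of_forall_notMem fun x ⟨ω, h1, _⟩ => hy ⟨ω, h1⟩
          simp [this]
    _ = ε := by simp

/-- The set `G` is not assumed measurable. -/
theorem one_sub_two_div_le_of_measure_le {Ω : Type*} [MeasurableSpace Ω] {μ : Measure Ω}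
    [IsProbabilityMeasure μ] {p : ℕ} (hp : 0 < p) {A G : Set Ω} (hA : MeasurableSet A)
    (hμ : μ A ≤ (p : ENNReal)⁻¹) (hG : Aᶜ ⊆ G) : 1 - 2 / (p : ℝ) ≤ μ.real G := by
  have h1 : μ.real A ≤ (p : ℝ)⁻¹ := by
    have h := ENNReal.toReal_mono (by simpa using hp.ne') hμ
    simpa [Measure.real] using h
  have h2 := measureReal_mono (μ := μ) hG
  rw [probReal_compl_eq_one_sub hA] at h2
  have h3 : (0 : ℝ) ≤ (p : ℝ)⁻¹ := by positivity
  rw [div_eq_mul_inv]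
  linarith

end NewSamp

theorem theorem1 :
    ∃ c : ℝ, 0 < c ∧
      ∀ (n p r : ℕ) [NeZero n] (_hr : r + 1 ≤ p)
        -- the feasible set and the functions `f_i`
        (C : Set (NewSamp.Param p)) (_hC : Convex ℝ C)
        (f : Fin n → NewSamp.Param p → ℝ)
        (_hf : ∀ i, ∀ θ ∈ C, ContDiffAt ℝ 2 (f i) θ)
        -- Lipschitz continuity of the sub-sampled Hessians
        (M : ℕ → ℝ)
        (_hM : ∀ A : Finset (Fin n), A.Nonempty → ∀ θ ∈ C, ∀ θ' ∈ C,
          ‖NewSamp.subHessian f A.val θ - NewSamp.subHessian f A.val θ'‖ ≤ M A.card * ‖θ - θ'‖)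
        -- boundedness of the Hessians
        (K : ℝ) (_hK : ∀ i, ∀ θ ∈ C, ‖NewSamp.hessian (f i) θ‖ ≤ K)
        -- the minimizer
        (θstar : NewSamp.Param p) (_hstar : θstar ∈ C)
        (_hmin : ∀ θ, NewSamp.objective f θstar ≤ NewSamp.objective f θ)
        -- the random samples
        (Ω : Type*) [MeasurableSpace Ω] (μ : MeasureTheory.Measure Ω)
        [MeasureTheory.IsProbabilityMeasure μ]
        (m : ℕ → ℕ) (_hm : ∀ t, 1 ≤ m t)
        (S : ℕ → Ω → Multiset (Fin n)) (_hS : NewSamp.IsIndependentSampling μ m S)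
        -- the step sizes: `η_t` may depend on the samples drawn up to time `t`
        (step : (t : ℕ) → (Fin (t + 1) → Multiset (Fin n)) → ℝ) (_hstep : ∀ t s, 0 ≤ step t s)
        (η : ℕ → Ω → ℝ) (_hη : ∀ t ω, η t ω = step t (fun τ => S τ ω))
        -- the iterates of the algorithm
        (θ₀ : NewSamp.Param p) (_hθ₀ : θ₀ ∈ C)
        (θ : ℕ → Ω → NewSamp.Param p) (_hinit : ∀ ω, θ 0 ω = θ₀)
        (_hrun : ∀ ω, NewSamp.IsRun f C r (fun t => η t ω) (fun t => S t ω) (fun t => θ t ω))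
        -- the eigenvalues `lam t i ω = λ_i^t` of `H_{S_t}(θ^t)`
        (lam : ℕ → ℕ → Ω → ℝ)
        (_hlam : ∀ t i ω, lam t i ω = NewSamp.eigval (NewSamp.subHessian f (S t ω) (θ t ω)) i)
        (t : ℕ),
        1 - 2 / (p : ℝ) ≤ μ.real {ω | 0 < lam t (r + 1) ω →
          η t ω ≤ 2 / (1 + lam t p ω / lam t (r + 1) ω) →
          ‖θ (t + 1) ω - θstar‖ ≤
            NewSamp.xi₁ c K (η t ω) (lam t p ω) (lam t (r + 1) ω) p (m t) * ‖θ t ω - θstar‖ +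
            NewSamp.xi₂ (M n) (η t ω) (lam t (r + 1) ω) * ‖θ t ω - θstar‖ ^ 2} := by

  refine ⟨12, by norm_num, ?_⟩
  intro n p r _ hr C hC f hf M hM K hK θstar hstar hmin Ω _ μ _ m hm S hS step hstep η hη θ₀ hθ₀
    θ hinit hrun lam hlam t
  rcases le_or_gt p 2 with hp2 | hp
  · have hp0 : (0 : ℝ) < p := by exact_mod_cast (by omega : 0 < p)
    have h2 : (1 : ℝ) ≤ 2 / p := by
      rw [le_div_iff₀ hp0, one_mul]
      exact_mod_cast hp2
    exact (by linarith : 1 - 2 / (p : ℝ) ≤ 0).trans MeasureTheory.measureReal_nonneg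
  have hθC : ∀ ω t, θ t ω ∈ C := fun ω => (hrun ω).mem (by rw [hinit]; exact hθ₀)
  have hSmeas : ∀ t, Measurable (S t) := fun t => (hS t).1.1
  have hpast : Measurable fun ω (τ : Fin t) => S τ ω :=
    measurable_pi_lambda _ fun τ => hSmeas τ
  have hadapted : ∀ ω ω', (fun τ : Fin t => S τ ω) = (fun τ : Fin t => S τ ω') →
      θ t ω = θ t ω' := by
    intro ω ω' h
    have hS' : ∀ τ < t, S τ ω = S τ ω' := fun τ hτ => congrFun h ⟨τ, hτ⟩
    refine (hrun ω).eq_of_samples_eq hC (hrun ω') (by rw [hinit, hinit]) (fun τ hτ => ?_) hS'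
    rw [hη, hη]
    exact congrArg (step τ) (funext fun σ => hS' σ (by omega))
  obtain ⟨hbad, hμbad⟩ := NewSamp.measurableSet_and_measure_le_of_indepFun (hSmeas t) hpast
    (hS t).2
    (B := fun ω => NewSamp.deviating p (fun i => NewSamp.hessian (f i) (θ t ω)) K (m t))
    (fun ω ω' h => by simp only [hadapted ω ω' h])
    fun ω => NewSamp.map_deviating_le (hS t).1 finrank_euclideanSpace_fin hp
      (fun i => NewSamp.isSymmetric_hessian (hf i _ (hθC ω t)))
      (fun i => hK i _ (hθC ω t)) (hm t)
  refine NewSamp.one_sub_two_div_le_of_measure_le (by omega) hbad hμbad fun ω hω hpos hstepsize => ?_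
  have hdev : ‖NewSamp.subHessian f (S t ω) (θ t ω) -
      NewSamp.subHessian f Finset.univ.val (θ t ω)‖ ≤
      12 * K * Real.sqrt (Real.log p / m t) := not_lt.1 hω
  rw [hlam] at hpos
  rw [hlam, hlam] at hstepsize
  have hη0 : 0 ≤ η t ω := by rw [hη]; exact hstep _ _
  have hgrad0 : gradient (NewSamp.objective f) θstar = 0 := by
    rw [gradient, IsLocalMin.fderiv_eq_zero (Filter.Eventually.of_forall hmin), map_zero]
  have htaylor := NewSamp.norm_sub_sub_apply_le hC
    (fun x hx => NewSamp.hasFDerivAt_gradient_objective fun i => hf i x hx)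
    (hM Finset.univ Finset.univ_nonempty) (hθC ω t) hstar
  have hrem : ‖gradient (NewSamp.objective f) (θ t ω) -
      NewSamp.subHessian f Finset.univ.val (θ t ω) (θ t ω - θstar)‖ ≤
      M n / 2 * ‖θ t ω - θstar‖ ^ 2 := by
    rw [hgrad0, Finset.card_univ, Fintype.card_fin, norm_sub_rev θstar, ← neg_sub (θ t ω) θstar,
      map_neg, zero_sub, sub_neg_eq_add, neg_add_eq_sub, norm_sub_rev] at htaylor
    exact htaylor
  refine ((hrun ω t).norm_sub_le hC hstar).trans
    ((NewSamp.norm_step_sub_le hr hpos hη0 hstepsize hdev hrem).trans (le_of_eq ?_))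
  rw [hlam, hlam, NewSamp.xi₁, NewSamp.xi₂]
  ring
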